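/- Let $\beta>1$ be real and $T_\beta(x)=\{\beta x\}$ (fractional part). The Rényi expansion of unity is $d_\beta(1)=t_1t_2t_3\cdots$ with $t_i=\lfloor\beta T_\beta^{i-1}(1)\rfloor$. Suppose that $\beta$ is a non-simple Parry number, i.e. the sequence $d_\beta(1)$ is eventually periodic but does not end in infinitely many zeros, and write $d_\beta(1)=t_1\cdots t_m(t_{m+1}\cdots t_{m+p})^\omega$ with the preperiod length $m\ge 0$ and the period length $p\ge 1$ minimal. Its Parry polynomial is $$p(x)=(x^p-1)\bigl(x^m-t_1x^{m-1}-\cdots-t_m\bigr)-t_{m+1}x^{p-1}-\cdots-t_{m+p-1}x-t_{m+p}.$$ The $\beta$-expansion of a real number $x>0$ is given by the greedy algorithm: let $k\in\mathbb Z$ satisfy $\beta^k\le x<\beta^{k+1}$, put $x_k=\lfloor x/\beta^k\rfloor$, $r_k=\{x/\beta^k\}$, and for $i<k$ put $x_i=\lfloor\beta r_{i+1}\rfloor$, $r_i=\{\beta r_{i+1}\}$; for $i>k$ put $x_i=0$. All digits of $x=0$ are $0$. Let $\mathbb Z_\beta^+$ be the set of all $x\ge 0$ with $x_i=0$ for all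 $i<0$ (the nonnegative $\beta$-integers), and let $0=b_0<b_1<b_2<\cdots$ be its strictly increasing enumeration. Then the limit $\lim_{n\to\infty} b_n/n$ exists and $$\lim_{n\to\infty}\frac{b_n}{n}=\frac{\beta-1}{\beta^m(\beta^p-1)}\,p'(\beta).$$ -/

import Mathlib

noncomputable section

/-- The `β`-transformation `T_β(x) = {β x}`. -/
def betaTransform (β x : ℝ) : ℝ := Int.fract (β * x)

/-- Digits of the Rényi expansion of unity `d_β(1) = t₁t₂t₃⋯`, indexed from `0`:
`renyiDigit β i` is `t_{i+1} = ⌊β T_β^i(1)⌋`. -/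
def renyiDigit (β : ℝ) (i : ℕ) : ℤ := ⌊β * (betaTransform β)^[i] 1⌋

/-- `d_β(1) = t₁⋯t_m (t_{m+1}⋯t_{m+p})^ω` with a nonempty repeated block;
`m` and `p` are not required to be minimal. -/
def IsRenyiPeriod (β : ℝ) (m p : ℕ) : Prop :=
  0 < p ∧ ∀ i, m ≤ i → renyiDigit β (i + p) = renyiDigit β i

/-- `d_β(1) = t₁⋯t_m (t_{m+1}⋯t_{m+p})^ω` with `m` and `p` minimal. -/
def IsMinimalRenyiPeriod (β : ℝ) (m p : ℕ) : Prop :=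
  IsRenyiPeriod β m p ∧ ∀ m' p', IsRenyiPeriod β m' p' → m ≤ m' ∧ p ≤ p'

/-- A Parry number: a real `β > 1` such that `d_β(1)` is eventually periodic. -/
def IsParryNumber (β : ℝ) : Prop := 1 < β ∧ ∃ m p, IsRenyiPeriod β m p

/-- A simple Parry number: a real `β > 1` such that `d_β(1)` is finite, i.e. ends in zeros. -/
def IsSimpleParryNumber (β : ℝ) : Prop :=
  1 < β ∧ ∃ m, ∀ i, m ≤ i → renyiDigit β i = 0

/-- A non-simple Parry number: `d_β(1)` is eventually periodic but not finite. -/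
def IsNonSimpleParryNumber (β : ℝ) : Prop := IsParryNumber β ∧ ¬ IsSimpleParryNumber β

/-- The Parry polynomial in the non-simple case,
`(x^p - 1)(x^m - t₁x^{m-1} - ⋯ - t_m) - t_{m+1}x^{p-1} - ⋯ - t_{m+p-1}x - t_{m+p}`. -/
def parryPolynomial (β : ℝ) (m p : ℕ) : Polynomial ℤ :=
  (Polynomial.X ^ p - 1) *
      (Polynomial.X ^ m -
        ∑ j ∈ Finset.range m, Polynomial.C (renyiDigit β j) * Polynomial.X ^ (m - 1 - j)) -
    ∑ j ∈ Finset.range p, Polynomial.C (renyiDigit β (m + j)) * Polynomial.X ^ (p - 1 - j)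

/-- For `x > 0`, the integer `k` with `β ^ k ≤ x < β ^ (k + 1)`
(see `betaTop_spec`). -/
def betaTop (β x : ℝ) : ℤ := ⌊Real.logb β x⌋

/-- The remainders of the greedy algorithm, counted downwards from the top position `k`:
`betaRemainder β x j` is `r_{k-j}`. -/
def betaRemainder (β x : ℝ) : ℕ → ℝ
  | 0 => Int.fract (x / β ^ betaTop β x)
  | j + 1 => Int.fract (β * betaRemainder β x j)

/-- The digits of the greedy algorithm, counted downwards from the top position `k`:
`betaDigitFromTop β x j` is `x_{k-j}`. -/
def betaDigitFromTop (β x : ℝ) : ℕ → ℤ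
  | 0 => ⌊x / β ^ betaTop β x⌋
  | j + 1 => ⌊β * betaRemainder β x j⌋

/-- The coefficient of `β ^ i` in the `β`-expansion of `x ≥ 0`: the greedy digit for `i ≤ k`,
and `0` above the top position; all digits of `0` are `0`. -/
def betaDigit (β x : ℝ) (i : ℤ) : ℤ :=
  if 0 < x ∧ i ≤ betaTop β x then betaDigitFromTop β x (betaTop β x - i).toNat else 0

/-- The set of nonnegative `β`-integers: the `x ≥ 0` whose `β`-expansion has
vanishing fractional part. -/
def nonnegBetaIntegers (β : ℝ) : Set ℝ := {x | 0 ≤ x ∧ ∀ i : ℤ, i < 0 → betaDigit β x i = 0}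

/-- `(b_n)` is the increasing enumeration of the nonnegative `β`-integers. For `β > 1` it exists
and is unique, see `existsUnique_betaIntegerSequence`. -/
def IsBetaIntegerSequence (β : ℝ) (b : ℕ → ℝ) : Prop :=
  StrictMono b ∧ b 0 = 0 ∧ Set.range b = nonnegBetaIntegers β

end

theorem betaTop_spec {β x : ℝ} (hβ : 1 < β) (hx : 0 < x) :
    β ^ betaTop β x ≤ x ∧ x < β ^ (betaTop β x + 1) := by
  have h0 : 0 < β := by linarith
  constructor
  · rw [← Real.rpow_intCast, ← Real.le_logb_iff_rpow_le hβ hx]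
    exact Int.floor_le _
  · rw [← Real.rpow_intCast, ← Real.logb_lt_iff_lt_rpow hβ hx]
    push_cast
    exact Int.lt_floor_add_one _

theorem betaTop_eq {β x : ℝ} (hβ : 1 < β) {k : ℤ} (h1 : β ^ k ≤ x) (h2 : x < β ^ (k + 1)) :
    betaTop β x = k := by
  have hx : 0 < x := lt_of_lt_of_le (zpow_pos (by linarith) k) h1
  obtain ⟨h3, h4⟩ := betaTop_spec hβ hx
  have h5 := (zpow_lt_zpow_iff_right₀ hβ).1 (lt_of_le_of_lt h1 h4)
  have h6 := (zpow_lt_zpow_iff_right₀ hβ).1 (lt_of_le_of_lt h3 h2)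
  omega

theorem betaRemainder_mem {β x : ℝ} (j : ℕ) :
    0 ≤ betaRemainder β x j ∧ betaRemainder β x j < 1 := by
  cases j <;> exact ⟨Int.fract_nonneg _, Int.fract_lt_one _⟩

/-- Invariant of the greedy algorithm. -/
theorem betaExpansion_partial (β x : ℝ) (j : ℕ) :
    β ^ j * (x / β ^ betaTop β x) =
      ∑ i ∈ Finset.range (j + 1), (betaDigitFromTop β x i : ℝ) * β ^ (j - i) +
        betaRemainder β x j := by
  induction j with
  | zero => simp [betaDigitFromTop, betaRemainder, Int.floor_add_fract]
  | succ j ih =>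
    rw [pow_succ', mul_assoc, ih, Finset.sum_range_succ _ (j + 1), mul_add, Finset.mul_sum]
    have h : β * betaRemainder β x j =
        (betaDigitFromTop β x (j + 1) : ℝ) + betaRemainder β x (j + 1) := by
      simp [betaDigitFromTop, betaRemainder, Int.floor_add_fract]
    rw [h, Nat.sub_self, pow_zero, mul_one, add_assoc]
    congr 1
    refine Finset.sum_congr rfl fun i hi => ?_
    have : j + 1 - i = (j - i) + 1 := by
      have := Finset.mem_range.1 hi
      omega
    rw [this, pow_succ]
    ring

theorem betaDigitFromTop_mem {β x : ℝ} (hβ : 1 < β) (hx : 0 < x) (j : ℕ) :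
    betaDigitFromTop β x j ∈ Finset.Icc 0 ⌊β⌋ := by
  have h0 : 0 < β := by linarith
  rw [Finset.mem_Icc]
  cases j with
  | zero =>
    obtain ⟨h1, h2⟩ := betaTop_spec hβ hx
    refine ⟨Int.floor_nonneg.2 (div_nonneg hx.le (zpow_nonneg h0.le _)), Int.floor_le_floor ?_⟩
    rw [div_le_iff₀ (zpow_pos h0 _), mul_comm, ← zpow_add_one₀ h0.ne']
    exact h2.le
  | succ j =>
    obtain ⟨h1, h2⟩ := betaRemainder_mem (β := β) (x := x) j
    refine ⟨Int.floor_nonneg.2 (mul_nonneg h0.le h1), Int.floor_le_floor ?_⟩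
    nlinarith

theorem nonnegBetaIntegers_eq_sum {β x : ℝ} (hβ : 1 < β) (hx : 0 < x)
    (h : x ∈ nonnegBetaIntegers β) :
    ∃ k : ℕ, betaTop β x = k ∧
      x = ∑ i ∈ Finset.range (k + 1), (betaDigitFromTop β x i : ℝ) * β ^ (k - i) := by
  have h0 : 0 < β := by linarith
  have hk : 0 ≤ betaTop β x := by
    by_contra hneg
    have h1 := h.2 _ (not_le.1 hneg)
    have h2 : (1 : ℝ) ≤ x / β ^ betaTop β x := by
      rw [le_div_iff₀ (zpow_pos h0 _), one_mul]
      exact (betaTop_spec hβ hx).1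
    have h3 : (1 : ℤ) ≤ ⌊x / β ^ betaTop β x⌋ := Int.le_floor.2 (by exact_mod_cast h2)
    simp only [betaDigit, hx, le_refl, and_self, if_true, sub_self, Int.toNat_zero,
      betaDigitFromTop] at h1
    omega
  obtain ⟨k, hk'⟩ := Int.eq_ofNat_of_zero_le hk
  refine ⟨k, hk', ?_⟩
  have hdig : ∀ j, betaDigitFromTop β x (k + j + 1) = 0 := by
    intro j
    have h1 := h.2 (-(j + 1 : ℤ)) (by omega)
    have h2 : -(j + 1 : ℤ) ≤ betaTop β x := by omega
    have h3 : (betaTop β x - -(j + 1 : ℤ)).toNat = k + j + 1 := by omega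
    simpa only [betaDigit, hx, h2, and_self, if_true, h3] using h1
  have hrem : ∀ j, betaRemainder β x (k + j) = β ^ j * betaRemainder β x k := by
    intro j
    induction j with
    | zero => simp
    | succ j ih =>
      have h1 : ⌊β * betaRemainder β x (k + j)⌋ = 0 := hdig j
      have h2 : betaRemainder β x (k + (j + 1)) = Int.fract (β * betaRemainder β x (k + j)) := rfl
      rw [h2, Int.fract, h1, ih, pow_succ']
      push_cast
      ring
  have hzero : betaRemainder β x k = 0 := by
    by_contra hne
    have hpos : 0 < betaRemainder β x k := lt_of_le_of_ne (betaRemainder_mem k).1 (Ne.symm hne)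
    obtain ⟨n, hn⟩ := pow_unbounded_of_one_lt (1 / betaRemainder β x k) hβ
    rw [div_lt_iff₀ hpos, ← hrem] at hn
    exact absurd (betaRemainder_mem (k + n)).2 (not_lt.2 hn.le)
  have := betaExpansion_partial β x k
  rw [hzero, add_zero, hk'] at this
  rw [← this]
  simp only [zpow_natCast]
  field_simp

theorem zero_mem_nonnegBetaIntegers (β : ℝ) : (0 : ℝ) ∈ nonnegBetaIntegers β := by
  refine ⟨le_rfl, fun i _ => ?_⟩
  simp [betaDigit]

theorem pow_mem_nonnegBetaIntegers {β : ℝ} (hβ : 1 < β) (k : ℕ) :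
    β ^ k ∈ nonnegBetaIntegers β := by
  have h0 : 0 < β := by linarith
  have htop : betaTop β (β ^ k) = k :=
    betaTop_eq hβ (by simp) (by
      rw [zpow_add_one₀ h0.ne', zpow_natCast]
      have := pow_pos h0 k
      nlinarith)
  have hrem : ∀ j, betaRemainder β (β ^ k) j = 0 := by
    intro j
    induction j with
    | zero =>
      simp [betaRemainder, htop, div_self (pow_pos h0 k).ne']
    | succ j ih => simp [betaRemainder, ih]
  refine ⟨(pow_pos h0 k).le, fun i hi => ?_⟩
  unfold betaDigit
  split_ifs with hc
  · obtain ⟨j, hj⟩ : ∃ j, (betaTop β (β ^ k) - i).toNat = j + 1 :=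
      ⟨(betaTop β (β ^ k) - i).toNat - 1, by omega⟩
    rw [hj]
    simp [betaDigitFromTop, hrem]
  · rfl

theorem nonnegBetaIntegers_inter_Iic_finite {β : ℝ} (hβ : 1 < β) (N : ℝ) :
    (nonnegBetaIntegers β ∩ Set.Iic N).Finite := by
  have h0 : 0 < β := by linarith
  obtain ⟨K, hK⟩ := pow_unbounded_of_one_lt N hβ
  have hfin : (insert (0 : ℝ) (⋃ k ∈ Finset.range K,
      (fun d : Fin (k + 1) → Finset.Icc (0 : ℤ) ⌊β⌋ =>
        ∑ i : Fin (k + 1), ((d i : ℤ) : ℝ) * β ^ (k - (i : ℕ))) '' Set.univ)).Finite := by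
    refine Set.Finite.insert _ (Set.Finite.biUnion (Finset.finite_toSet _) fun k _ => ?_)
    exact Set.finite_univ.image _
  refine hfin.subset ?_
  rintro x ⟨hx, hxN⟩
  rcases hx.1.eq_or_lt with h | hpos
  · exact Or.inl h.symm
  · obtain ⟨k, hk, hsum⟩ := nonnegBetaIntegers_eq_sum hβ hpos hx
    right
    simp only [Set.mem_iUnion]
    refine ⟨k, ?_, fun i => ⟨betaDigitFromTop β x i, betaDigitFromTop_mem hβ hpos i⟩,
      Set.mem_univ _, ?_⟩
    · have h1 := (betaTop_spec hβ hpos).1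
      rw [hk, zpow_natCast] at h1
      have h2 : β ^ k < β ^ K := lt_of_le_of_lt h1 (lt_of_le_of_lt hxN hK)
      exact Finset.mem_range.2 ((pow_lt_pow_iff_right₀ hβ).1 h2)
    · conv_rhs => rw [hsum]
      exact Fin.sum_univ_eq_sum_range
        (fun i => (betaDigitFromTop β x i : ℝ) * β ^ (k - i)) (k + 1)

theorem existsUnique_betaIntegerSequence {β : ℝ} (hβ : 1 < β) :
    ∃! b : ℕ → ℝ, IsBetaIntegerSequence β b := by
  classical
  have hfin := nonnegBetaIntegers_inter_Iic_finite hβ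
  have hnext : ∀ y : ℝ, ∃ z, z ∈ nonnegBetaIntegers β ∧ y < z ∧
      ∀ w ∈ nonnegBetaIntegers β, y < w → z ≤ w := by
    intro y
    obtain ⟨K, hK⟩ := pow_unbounded_of_one_lt y hβ
    have hf : (nonnegBetaIntegers β ∩ Set.Iic (β ^ K) ∩ Set.Ioi y).Finite :=
      (hfin _).subset Set.inter_subset_left
    obtain ⟨z, hz, hmin⟩ := Set.exists_min_image _ id hf
      ⟨β ^ K, ⟨pow_mem_nonnegBetaIntegers hβ K, Set.mem_Iic.2 le_rfl⟩, hK⟩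
    refine ⟨z, hz.1.1, hz.2, fun w hw hyw => ?_⟩
    by_cases hwK : w ≤ β ^ K
    · exact hmin w ⟨⟨hw, hwK⟩, hyw⟩
    · exact le_trans hz.1.2 (not_le.1 hwK).le
  choose s hs1 hs2 hs3 using hnext
  let b : ℕ → ℝ := fun n => s^[n] 0
  have hsucc : ∀ n, b (n + 1) = s (b n) := fun n => Function.iterate_succ_apply' s n 0
  have hmono : StrictMono b := strictMono_nat_of_lt_succ fun n => by
    rw [hsucc]
    exact hs2 _
  have hmem : ∀ n, b n ∈ nonnegBetaIntegers β := by
    intro n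
    cases n with
    | zero => exact zero_mem_nonnegBetaIntegers β
    | succ n =>
      rw [hsucc]
      exact hs1 _
  have hrange : Set.range b = nonnegBetaIntegers β := by
    refine Set.Subset.antisymm (Set.range_subset_iff.2 hmem) fun x hx => ?_
    by_contra hne
    have hlt : ∀ n, b n < x := by
      intro n
      induction n with
      | zero => exact lt_of_le_of_ne hx.1 fun h => hne ⟨0, h⟩
      | succ n ih =>
        refine lt_of_le_of_ne ?_ fun h => hne ⟨n + 1, h⟩
        rw [hsucc]
        exact hs3 _ x hx ih
    exact Set.infinite_range_of_injective hmono.injective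
      ((hfin x).subset (Set.range_subset_iff.2 fun n => ⟨hmem n, (hlt n).le⟩))
  refine ⟨b, ⟨hmono, rfl, hrange⟩, fun c hc => ?_⟩
  exact (hc.1.range_inj hmono).1 (hc.2.2.trans hrange.symm)

/-!
Let `T = T_β`, let `r_j = T^j 1`, and let `F_k(y)` be the number of `z ∈ [0, y)` with `T^k z = 0`
(`terminatingPoints`). Multiplication by `β ^ k` turns these points into the `β`-integers below
`β ^ k y`, for `y ≤ 1`, so the index of a `β`-integer is `n = F_k(b_n / β ^ k)` as soon as
`b_n ≤ β ^ k` (`ncard_terminatingPoints_betaInteger`). It remains to find the growth of `F_k`.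

Splitting `z` into its leading digit and `T z` gives
`F_{k+1}(y) = ⌊β y⌋ F_k(1) + F_k(T y)` (`ncard_terminatingPoints_succ`). Along the orbit of `1`, which
never meets `0` because `β` is not simple, this becomes the renewal equation
`F_{k+1}(1) = ∑_{i ≤ k} t_{i+1} F_{k-i}(1) + 1`. The weights `t_{i+1} / β ^ (i+1)` sum to `1`, with
tails `r_j / β ^ j`, and the first one is positive, so the renewal theorem (`tendsto_of_renewal`)
gives `F_k(1) / β ^ k → c` with `c = β / (β - 1) / G` and `G = ∑ r_j / β ^ j`. The recursion then
carries this over to `F_k(y)`, up to an error `ε β ^ k y + C` with `C` independent of `k` and `y`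
(`abs_ncard_terminatingPoints_sub_le`); hence `n / b_n → c`.

Finally, put `Q_n(x) = x ^ n - t_1 x ^ (n-1) - ⋯ - t_n`. Then `Q_n(β) = r_n`, the Parry polynomial is
`Q_{m+p} - Q_m`, and differentiating `Q_{n+1} = x Q_n - t_{n+1}` yields
`β Q_n'(β) = β ^ n ∑_{j < n} r_j / β ^ j`. As `(r_j)` has period `p` from `m` on, the geometric series
gives `β ^ m (β ^ p - 1) G = β p'(β)` (`tsum_renyiRemainder_div_pow`), which identifies `1 / c`.
-/

/-! ### A renewal theorem -/

open Filter Topology in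
/-- Limits along a filter `l ≤ atTop` pass through a convolution with summable weights. -/
theorem tendsto_convolution_of_summable {c u v : ℕ → ℝ} {M : ℝ} (hc : ∀ j, 0 ≤ c j)
    (hcs : Summable c) (hu : ∀ k, |u k| ≤ M) {l : Filter ℕ} (hl : l ≤ atTop)
    (hv : ∀ j, Tendsto (fun k => u (k - j)) l (𝓝 (v j))) :
    Tendsto (fun k => ∑ j ∈ Finset.range (k + 1), c j * u (k - j)) l
      (𝓝 (∑' j, c j * v j)) := by
  have key : Tendsto (fun k => ∑' j, if j < k + 1 then c j * u (k - j) else 0) l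
      (𝓝 (∑' j, c j * v j)) := by
    refine tendsto_tsum_of_dominated_convergence (bound := fun j => c j * M)
      (hcs.mul_right M) (fun j => ?_) (Eventually.of_forall fun k j => ?_)
    · refine ((hv j).const_mul (c j)).congr' ?_
      filter_upwards [hl (eventually_ge_atTop j)] with k hk
      rw [if_pos (Nat.lt_succ_of_le hk)]
    · have hM : 0 ≤ M := (abs_nonneg _).trans (hu 0)
      split_ifs
      · rw [Real.norm_eq_abs, abs_mul, abs_of_nonneg (hc j)]
        exact mul_le_mul_of_nonneg_left (hu _) (hc j)
      · simpa using mul_nonneg (hc j) hM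
  refine key.congr fun k => ?_
  rw [tsum_eq_sum (s := Finset.range (k + 1)) (fun j hj => if_neg (by simpa using hj))]
  exact Finset.sum_congr rfl fun j hj => if_pos (Finset.mem_range.1 hj)

open Filter Topology in
theorem exists_ultrafilter_tendsto_of_abs_le {u : ℕ → ℝ} {M : ℝ} (hu : ∀ k, |u k| ≤ M)
    (U : Ultrafilter ℕ) : ∃ x, Tendsto u U (𝓝 x) := by
  obtain ⟨x, -, hx⟩ := (isCompact_Icc (a := -M) (b := M)).ultrafilter_le_nhds (U.map u)
    (by
      rw [le_principal_iff]
      exact Filter.mem_map.2 (Filter.univ_mem' fun k => abs_le.1 (hu k)))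
  exact ⟨x, hx⟩

open Filter Topology in
/-- Maximum principle: a weighted mean of limit points equal to the largest limit point `L` forces
each limit point of positive weight to be `L`. -/
theorem tendsto_of_tendsto_succ_of_max {a u e : ℕ → ℝ} {M L : ℝ} (ha : ∀ i, 0 ≤ a i)
    (ha0 : 0 < a 0) (hsum : HasSum a 1) (hu : ∀ k, |u k| ≤ M)
    (hrec : ∀ k, u (k + 1) = ∑ i ∈ Finset.range (k + 1), a i * u (k - i) + e k)
    (he : Tendsto e atTop (𝓝 0)) (hmax : ∀ x, MapClusterPt x atTop u → x ≤ L)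
    {V : Ultrafilter ℕ} (hV : (V : Filter ℕ) ≤ atTop)
    (hL : Tendsto (fun k => u (k + 1)) V (𝓝 L)) : Tendsto u V (𝓝 L) := by
  choose v hv using fun j : ℕ =>
    exists_ultrafilter_tendsto_of_abs_le (u := fun k => u (k - j)) (M := M) (fun k => hu _) V
  have hvL : ∀ j, v j ≤ L := fun j => by
    refine hmax _ (mapClusterPt_iff_ultrafilter.2 ⟨V.map (fun k => k - j), ?_, ?_⟩)
    · exact ((tendsto_sub_atTop_nat j).mono_left hV)
    · exact hv j
  have hconv := tendsto_convolution_of_summable ha hsum.summable hu hV hv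
  have hlim : L = ∑' j, a j * v j := by
    refine tendsto_nhds_unique hL ?_
    simpa [hrec] using hconv.add (he.mono_left hV)
  have hvM : ∀ j, |v j| ≤ M := fun j =>
    le_of_tendsto (hv j).abs (Eventually.of_forall fun k => hu _)
  have hs1 : Summable fun j => a j * v j := by
    refine Summable.of_norm_bounded (hsum.summable.mul_right M) fun j => ?_
    rw [Real.norm_eq_abs, abs_mul, abs_of_nonneg (ha j)]
    exact mul_le_mul_of_nonneg_left (hvM j) (ha j)
  have hdiff : HasSum (fun j => a j * (L - v j)) 0 := by
    have := (hsum.mul_right L).sub hs1.hasSum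
    rw [← hlim, one_mul, sub_self] at this
    simpa [mul_sub] using this
  have hz := (hasSum_zero_iff_of_nonneg
    (fun j => mul_nonneg (ha j) (sub_nonneg.2 (hvL j)))).1 hdiff
  -- Only the term `j = 0` is needed, and its weight is positive.
  have h0 : v 0 = L := by
    have := congrFun hz 0
    have := (mul_eq_zero.1 this).resolve_left ha0.ne'
    linarith
  simpa [h0] using hv 0

open Filter Topology in
/-- The largest limit point of `u` is determined by the limit of the convolution with `R`: along an
ultrafilter where `u` tends to its largest limit point, so do all shifts of `u`. -/
theorem max_clusterPt_mul_tsum {a u e R : ℕ → ℝ} {M L S : ℝ} (ha : ∀ i, 0 ≤ a i)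
    (ha0 : 0 < a 0) (hsum : HasSum a 1) (hR : ∀ j, 0 ≤ R j) (hRs : Summable R)
    (hu : ∀ k, |u k| ≤ M)
    (hrec : ∀ k, u (k + 1) = ∑ i ∈ Finset.range (k + 1), a i * u (k - i) + e k)
    (he : Tendsto e atTop (𝓝 0))
    (hS : Tendsto (fun k => ∑ j ∈ Finset.range (k + 1), R j * u (k - j)) atTop (𝓝 S))
    (hL : MapClusterPt L atTop u) (hmax : ∀ x, MapClusterPt x atTop u → x ≤ L) :
    (∑' j, R j) * L = S := by
  obtain ⟨U, hU, hUL⟩ := mapClusterPt_iff_ultrafilter.1 hL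
  have hall : ∀ j, Tendsto (fun k => u (k - j)) U (𝓝 L) := by
    intro j
    induction j with
    | zero => simpa using hUL
    | succ j ih =>
      have hV : ((U.map fun k => k - (j + 1) : Ultrafilter ℕ) : Filter ℕ) ≤ atTop :=
        (tendsto_sub_atTop_nat (j + 1)).mono_left hU
      refine tendsto_of_tendsto_succ_of_max (V := U.map fun k => k - (j + 1))
        ha ha0 hsum hu hrec he hmax hV ?_
      change Tendsto (fun k => u (k - (j + 1) + 1)) U (𝓝 L)
      refine ih.congr' ?_
      filter_upwards [hU (eventually_ge_atTop (j + 1))] with k hk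
      congr 1
      omega
  have := tendsto_convolution_of_summable hR hRs hu hU hall
  rw [tsum_mul_right] at this
  exact tendsto_nhds_unique this (hS.mono_left hU)

open Filter Topology in
/-- A form of the renewal theorem: a bounded solution `u` of a renewal equation with weights `a` of
total mass `1` and vanishing inhomogeneity `e` converges, provided `a 0 > 0` (which excludes a
periodic solution). The value of the limit comes from a second summable kernel `R` whose convolution
with `u` is known to converge; in applications `R` is the sequence of tails of `a`. -/
theorem tendsto_of_renewal {a u e R : ℕ → ℝ} {M S : ℝ} (ha : ∀ i, 0 ≤ a i)
    (ha0 : 0 < a 0) (hsum : HasSum a 1) (hR : ∀ j, 0 ≤ R j) (hR0 : 0 < R 0) (hRs : Summable R)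
    (hu : ∀ k, |u k| ≤ M)
    (hrec : ∀ k, u (k + 1) = ∑ i ∈ Finset.range (k + 1), a i * u (k - i) + e k)
    (he : Tendsto e atTop (𝓝 0))
    (hS : Tendsto (fun k => ∑ j ∈ Finset.range (k + 1), R j * u (k - j)) atTop (𝓝 S)) :
    Tendsto u atTop (𝓝 (S / ∑' j, R j)) := by
  have hG : 0 < ∑' j, R j := hRs.tsum_pos hR 0 hR0
  have hIcc : ∀ᶠ k in atTop, u k ∈ Set.Icc (-M) M := Eventually.of_forall fun k => abs_le.1 (hu k)
  -- The limit points of `u` form a nonempty compact set.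
  set K : Set ℝ := {x | MapClusterPt x atTop u} with hK
  have hKsub : K ⊆ Set.Icc (-M) M := fun x hx =>
    isClosed_Icc.mem_of_mapClusterPt hx hIcc
  have hKc : IsCompact K :=
    isCompact_Icc.of_isClosed_subset isClosed_setOfPred_clusterPt hKsub
  have hKn : K.Nonempty := by
    obtain ⟨x, -, hx⟩ := isCompact_Icc.exists_mapClusterPt (le_principal_iff.2 hIcc)
    exact ⟨x, hx⟩
  obtain ⟨L, hL, hLmax⟩ := hKc.exists_isGreatest hKn
  obtain ⟨l, hl, hlmin⟩ := hKc.exists_isLeast hKn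
  have h1 := max_clusterPt_mul_tsum ha ha0 hsum hR hRs hu hrec he hS hL fun x hx => hLmax hx
  have hneg : ∀ x, MapClusterPt x atTop (fun k => -u k) → MapClusterPt (-x) atTop u :=
    fun x hx => by
      simpa [Function.comp_def] using hx.continuousAt_comp (continuous_neg.continuousAt (x := x))
  -- The least limit point of `u` is minus the largest one of `-u`.
  have h2 := max_clusterPt_mul_tsum (u := fun k => -u k) (e := fun k => -e k) (S := -S) (M := M)
    (L := -l) ha ha0 hsum hR hRs (fun k => by simpa using hu k)
    (fun k => by simp [hrec k]; ring) (by simpa using he.neg) (by simpa using hS.neg)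
    (hl.continuousAt_comp continuous_neg.continuousAt)
    (fun x hx => by have := hlmin (hneg x hx); linarith)
  have hLl : l = L := by
    have : (∑' j, R j) * (L - l) = 0 := by linarith
    rcases mul_eq_zero.1 this with h | h <;> linarith
  have hLS : L = S / ∑' j, R j := by
    rw [eq_div_iff hG.ne', mul_comm]
    exact h1
  rw [← hLS]
  refine isCompact_Icc.le_nhds_of_unique_clusterPt hIcc fun x _ hx => ?_
  exact le_antisymm (hLmax hx) (hLl ▸ hlmin hx)

/-- When `R` is the sequence of tails of `a`, the convolution of `R` with a solution of the renewal
equation only accumulates the inhomogeneity. -/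
theorem sum_succ_convolution_of_renewal {a u e R : ℕ → ℝ} (hR0 : R 0 = 1)
    (hR : ∀ j, R (j + 1) = R j - a j)
    (hrec : ∀ k, u (k + 1) = ∑ i ∈ Finset.range (k + 1), a i * u (k - i) + e k) (k : ℕ) :
    ∑ j ∈ Finset.range (k + 1 + 1), R j * u (k + 1 - j) =
      ∑ j ∈ Finset.range (k + 1), R j * u (k - j) + e k := by
  rw [Finset.sum_range_succ', hR0, one_mul, Nat.sub_zero, hrec]
  simp only [hR, Nat.add_sub_add_right, sub_mul, Finset.sum_sub_distrib]
  ring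

/-! ### The orbit of one -/

theorem betaTransform_mem {β x : ℝ} : 0 ≤ betaTransform β x ∧ betaTransform β x < 1 :=
  ⟨Int.fract_nonneg _, Int.fract_lt_one _⟩

/-- The orbit `r_j = T_β^j(1)` of `1`, the remainders in the Rényi expansion of unity. -/
noncomputable def renyiRemainder (β : ℝ) (j : ℕ) : ℝ := (betaTransform β)^[j] 1

theorem renyiRemainder_succ (β : ℝ) (j : ℕ) :
    renyiRemainder β (j + 1) = β * renyiRemainder β j - renyiDigit β j := by
  rw [renyiRemainder, Function.iterate_succ_apply']
  rfl

theorem renyiRemainder_mem (β : ℝ) (j : ℕ) :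
    0 ≤ renyiRemainder β j ∧ renyiRemainder β j ≤ 1 := by
  cases j with
  | zero => simp [renyiRemainder]
  | succ j =>
    rw [renyiRemainder, Function.iterate_succ_apply']
    exact ⟨betaTransform_mem.1, betaTransform_mem.2.le⟩

theorem renyiDigit_nonneg {β : ℝ} (hβ : 1 < β) (j : ℕ) : 0 ≤ renyiDigit β j :=
  Int.floor_nonneg.2 (mul_nonneg (by linarith) (renyiRemainder_mem β j).1)

/-- If the orbit of `1` met `0`, it would stay there and `d_β(1)` would be finite. -/
theorem renyiRemainder_pos {β : ℝ} (hβ : IsNonSimpleParryNumber β) (j : ℕ) :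
    0 < renyiRemainder β j := by
  refine lt_of_le_of_ne (renyiRemainder_mem β j).1 fun h => hβ.2 ⟨hβ.1.1, j, fun i hi => ?_⟩
  obtain ⟨n, rfl⟩ := Nat.exists_eq_add_of_le hi
  have hzero : renyiRemainder β (j + n) = 0 := by
    induction n with
    | zero => exact h.symm
    | succ n ih =>
      rw [← add_assoc, renyiRemainder, Function.iterate_succ_apply']
      have h0 := ih (Nat.le_add_right j n)
      rw [renyiRemainder] at h0
      simp [h0, betaTransform]
  rw [renyiRemainder] at hzero
  simp [renyiDigit, hzero]

/-- Equal digits keep the difference of two remainders growing like `β ^ k`, so bounded remainders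
must coincide. -/
theorem renyiRemainder_add_period {β : ℝ} (hβ : 1 < β) {m p : ℕ} (h : IsRenyiPeriod β m p)
    {j : ℕ} (hj : m ≤ j) : renyiRemainder β (j + p) = renyiRemainder β j := by
  have hk : ∀ k, renyiRemainder β (j + k + p) - renyiRemainder β (j + k) =
      β ^ k * (renyiRemainder β (j + p) - renyiRemainder β j) := by
    intro k
    induction k with
    | zero => simp
    | succ k ih =>
      have hd := h.2 (j + k) (by omega)
      rw [show j + (k + 1) + p = (j + k + p) + 1 by ring, ← add_assoc, renyiRemainder_succ,
        renyiRemainder_succ, hd, pow_succ']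
      linear_combination β * ih
  by_contra hne
  have hpos : 0 < |renyiRemainder β (j + p) - renyiRemainder β j| :=
    abs_pos.2 (sub_ne_zero.2 hne)
  obtain ⟨n, hn⟩ := pow_unbounded_of_one_lt
    (1 / |renyiRemainder β (j + p) - renyiRemainder β j|) hβ
  rw [div_lt_iff₀ hpos, ← abs_of_pos (pow_pos (by linarith : 0 < β) n), ← abs_mul, ← hk] at hn
  have h1 := renyiRemainder_mem β (j + n + p)
  have h2 := renyiRemainder_mem β (j + n)
  have := abs_le.2 (⟨by linarith, by linarith⟩ : -1 ≤ renyiRemainder β (j + n + p) -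
    renyiRemainder β (j + n) ∧ renyiRemainder β (j + n + p) - renyiRemainder β (j + n) ≤ 1)
  linarith

theorem summable_renyiRemainder_div_pow {β : ℝ} (hβ : 1 < β) :
    Summable fun j => renyiRemainder β j / β ^ j := by
  have h0 : 0 < β := by linarith
  refine Summable.of_nonneg_of_le (fun j => div_nonneg (renyiRemainder_mem β j).1 (by positivity))
    (fun j => ?_) (summable_geometric_of_lt_one (inv_nonneg.2 h0.le) (inv_lt_one_of_one_lt₀ hβ))
  rw [inv_pow, ← one_div]
  gcongr
  exact (renyiRemainder_mem β j).2

/-! ### The derivative of the Parry polynomial -/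

/-- The polynomial `Q_n = x ^ n - t_1 x ^ (n-1) - ⋯ - t_n`, whose value at `β` is the remainder
`r_n`. -/
noncomputable def renyiPolynomial (β : ℝ) (n : ℕ) : Polynomial ℤ :=
  Polynomial.X ^ n -
    ∑ j ∈ Finset.range n, Polynomial.C (renyiDigit β j) * Polynomial.X ^ (n - 1 - j)

theorem renyiPolynomial_succ (β : ℝ) (n : ℕ) :
    renyiPolynomial β (n + 1) =
      Polynomial.X * renyiPolynomial β n - Polynomial.C (renyiDigit β n) := by
  have h : ∑ j ∈ Finset.range n, Polynomial.C (renyiDigit β j) * Polynomial.X ^ (n - j) =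
      Polynomial.X * ∑ j ∈ Finset.range n,
        Polynomial.C (renyiDigit β j) * Polynomial.X ^ (n - 1 - j) := by
    rw [Finset.mul_sum]
    refine Finset.sum_congr rfl fun j hj => ?_
    have := Finset.mem_range.1 hj
    rw [show n - j = (n - 1 - j) + 1 by omega, pow_succ]
    ring
  simp only [renyiPolynomial, Finset.sum_range_succ, Nat.add_sub_cancel, h]
  simp
  ring

theorem renyiPolynomial_add (β : ℝ) (m p : ℕ) :
    renyiPolynomial β (m + p) = Polynomial.X ^ p * renyiPolynomial β m -
      ∑ j ∈ Finset.range p,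
        Polynomial.C (renyiDigit β (m + j)) * Polynomial.X ^ (p - 1 - j) := by
  induction p with
  | zero => simp
  | succ p ih =>
    have h : ∑ j ∈ Finset.range p,
          Polynomial.C (renyiDigit β (m + j)) * Polynomial.X ^ (p - j) =
        Polynomial.X * ∑ j ∈ Finset.range p,
          Polynomial.C (renyiDigit β (m + j)) * Polynomial.X ^ (p - 1 - j) := by
      rw [Finset.mul_sum]
      refine Finset.sum_congr rfl fun j hj => ?_
      have := Finset.mem_range.1 hj
      rw [show p - j = (p - 1 - j) + 1 by omega, pow_succ]
      ring
    rw [← add_assoc, renyiPolynomial_succ, ih]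
    simp only [Finset.sum_range_succ, Nat.add_sub_cancel, h]
    simp
    ring

theorem parryPolynomial_eq_sub (β : ℝ) (m p : ℕ) :
    parryPolynomial β m p = renyiPolynomial β (m + p) - renyiPolynomial β m := by
  rw [renyiPolynomial_add, parryPolynomial, ← renyiPolynomial]
  ring

theorem aeval_renyiPolynomial (β : ℝ) (n : ℕ) :
    Polynomial.aeval β (renyiPolynomial β n) = renyiRemainder β n := by
  induction n with
  | zero => simp [renyiPolynomial, renyiRemainder]
  | succ n ih =>
    rw [renyiPolynomial_succ, renyiRemainder_succ, ← ih]
    simp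

theorem aeval_derivative_renyiPolynomial {β : ℝ} (hβ : 1 < β) (n : ℕ) :
    β * Polynomial.aeval β (Polynomial.derivative (renyiPolynomial β n)) =
      β ^ n * ∑ j ∈ Finset.range n, renyiRemainder β j / β ^ j := by
  have h0 : β ≠ 0 := by linarith
  induction n with
  | zero => simp [renyiPolynomial]
  | succ n ih =>
    have h1 : Polynomial.aeval β (Polynomial.derivative (renyiPolynomial β (n + 1))) =
        renyiRemainder β n +
          β * Polynomial.aeval β (Polynomial.derivative (renyiPolynomial β n)) := by
      rw [renyiPolynomial_succ, ← aeval_renyiPolynomial]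
      simp
    rw [h1, Finset.sum_range_succ, ih]
    field_simp
    ring

/-- The series `∑ r_j / β ^ j` in closed form: from the index `m` on its terms repeat with period `p`
up to the factor `β ^ (-p)`. -/
theorem tsum_renyiRemainder_div_pow {β : ℝ} (hβ : 1 < β) {m p : ℕ} (h : IsRenyiPeriod β m p) :
    β ^ m * (β ^ p - 1) * ∑' j, renyiRemainder β j / β ^ j =
      β * Polynomial.aeval β (Polynomial.derivative (parryPolynomial β m p)) := by
  have h0 : 0 < β := by linarith
  have hs := summable_renyiRemainder_div_pow hβ
  have h1 := hs.sum_add_tsum_nat_add m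
  have h2 := hs.sum_add_tsum_nat_add (m + p)
  have h3 : β ^ p * ∑' j, renyiRemainder β (j + (m + p)) / β ^ (j + (m + p)) =
      ∑' j, renyiRemainder β (j + m) / β ^ (j + m) := by
    rw [← tsum_mul_left]
    refine tsum_congr fun j => ?_
    rw [← add_assoc, renyiRemainder_add_period hβ h (Nat.le_add_left m j), pow_add β (j + m) p]
    field_simp
  rw [parryPolynomial_eq_sub, Polynomial.derivative_sub, map_sub, mul_sub β,
    aeval_derivative_renyiPolynomial hβ, aeval_derivative_renyiPolynomial hβ, pow_add]
  linear_combination (-(β ^ m * β ^ p)) * h2 + β ^ m * h1 + β ^ m * h3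

/-! ### Counting points with a finite expansion -/

/-- The points `z ∈ [0, y)` with `T_β^k(z) = 0`. For `y ≤ 1` these are the points whose greedy
expansion has at most `k` fractional digits. -/
def terminatingPoints (β : ℝ) (k : ℕ) (y : ℝ) : Set ℝ :=
  {z | 0 ≤ z ∧ z < y ∧ (betaTransform β)^[k] z = 0}

/-- A point `z` amounts to its leading digit `a = ⌊β z⌋` together with `w = T_β z`; it lies below `y`
when `a` is below the leading digit of `y`, or equals it and `w < T_β y`. -/
theorem terminatingPoints_succ {β : ℝ} (hβ : 1 < β) (k : ℕ) {y : ℝ} (hy : 0 ≤ y) :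
    terminatingPoints β (k + 1) y = (fun w : ℕ × ℝ => (w.1 + w.2) / β) ''
      (Set.Iio ⌊β * y⌋₊ ×ˢ terminatingPoints β k 1 ∪
        {⌊β * y⌋₊} ×ˢ terminatingPoints β k (betaTransform β y)) := by
  have h0 : 0 < β := by linarith
  have hsplit : ∀ z : ℝ, 0 ≤ z → β * z = ⌊β * z⌋₊ + betaTransform β z := fun z hz => by
    rw [natCast_floor_eq_intCast_floor (mul_nonneg h0.le hz), betaTransform, Int.floor_add_fract]
  have hT : ∀ (a : ℕ) (w : ℝ), 0 ≤ w → w < 1 → betaTransform β ((a + w) / β) = w := by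
    intro a w hw0 hw1
    rw [betaTransform, mul_div_cancel₀ _ h0.ne', Int.fract_natCast_add]
    exact Int.fract_eq_self.2 ⟨hw0, hw1⟩
  ext z
  constructor
  · rintro ⟨hz0, hzy, hz⟩
    rw [Function.iterate_succ_apply] at hz
    refine ⟨(⌊β * z⌋₊, betaTransform β z), ?_, ?_⟩
    · have hle : ⌊β * z⌋₊ ≤ ⌊β * y⌋₊ := Nat.floor_le_floor (by gcongr)
      rcases hle.lt_or_eq with h | h
      · exact Or.inl ⟨h, betaTransform_mem.1, betaTransform_mem.2, hz⟩
      · refine Or.inr ⟨h, betaTransform_mem.1, ?_, hz⟩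
        have h1 := hsplit z hz0
        have h2 := hsplit y hy
        rw [h] at h1
        have : β * z < β * y := by gcongr
        linarith
    · simp only
      rw [← hsplit z hz0, mul_div_cancel_left₀ _ h0.ne']
  · rintro ⟨⟨a, w⟩, h | h, rfl⟩
    · obtain ⟨ha, hw0, hw1, hw⟩ := h
      refine ⟨by positivity, ?_, ?_⟩
      · rw [div_lt_iff₀ h0, mul_comm y]
        have h1 : (a : ℝ) + 1 ≤ ⌊β * y⌋₊ := by exact_mod_cast ha
        have h2 := Nat.floor_le (mul_nonneg h0.le hy)
        simp only at hw1 ⊢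
        linarith
      · rw [Function.iterate_succ_apply, hT a w hw0 hw1]
        exact hw
    · obtain ⟨ha, hw0, hw1, hw⟩ := h
      simp only [Set.mem_singleton_iff] at ha
      subst ha
      refine ⟨by positivity, ?_, ?_⟩
      · rw [div_lt_iff₀ h0, mul_comm y]
        have := hsplit y hy
        simp only at hw1 ⊢
        linarith
      · rw [Function.iterate_succ_apply, hT _ w hw0 (hw1.trans betaTransform_mem.2)]
        exact hw

theorem terminatingPoints_zero (β : ℝ) {y : ℝ} (hy : 0 < y) : terminatingPoints β 0 y = {0} := by
  ext z
  simp only [terminatingPoints, Function.iterate_zero, id, Set.mem_ofPred_eq, Set.mem_singleton_iff]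
  exact ⟨fun h => h.2.2, fun h => by subst h; exact ⟨le_rfl, hy, rfl⟩⟩

theorem terminatingPoints_mono (β : ℝ) (k : ℕ) : Monotone (terminatingPoints β k) :=
  fun _ _ hxy _ hz => ⟨hz.1, hz.2.1.trans_le hxy, hz.2.2⟩

theorem finite_terminatingPoints {β : ℝ} (hβ : 1 < β) (k : ℕ) {y : ℝ} (hy : 0 ≤ y) :
    (terminatingPoints β k y).Finite := by
  induction k generalizing y with
  | zero => exact (Set.finite_singleton (0 : ℝ)).subset fun z hz => hz.2.2
  | succ k ih =>
    rw [terminatingPoints_succ hβ k hy]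
    exact (((Set.finite_Iio _).prod (ih zero_le_one)).union
      ((Set.finite_singleton _).prod (ih betaTransform_mem.1))).image _

theorem ncard_terminatingPoints_succ {β : ℝ} (hβ : 1 < β) (k : ℕ) {y : ℝ} (hy : 0 ≤ y) :
    (terminatingPoints β (k + 1) y).ncard = ⌊β * y⌋₊ * (terminatingPoints β k 1).ncard +
      (terminatingPoints β k (betaTransform β y)).ncard := by
  have h0 : 0 < β := by linarith
  rw [terminatingPoints_succ hβ k hy, Set.InjOn.ncard_image,
    Set.ncard_union_eq ?_ ((Set.finite_Iio _).prod (finite_terminatingPoints hβ k zero_le_one))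
      ((Set.finite_singleton _).prod (finite_terminatingPoints hβ k betaTransform_mem.1)),
    Set.ncard_prod, Set.ncard_prod, Set.ncard_singleton, one_mul]
  · congr 2
    rw [← Finset.coe_Iio, Set.ncard_coe_finset, Nat.card_Iio]
  · rw [Set.disjoint_left]
    rintro ⟨a, w⟩ h1 h2
    exact absurd h2.1 (ne_of_lt h1.1)
  · have hw : ∀ x ∈ Set.Iio ⌊β * y⌋₊ ×ˢ terminatingPoints β k 1 ∪
        {⌊β * y⌋₊} ×ˢ terminatingPoints β k (betaTransform β y), 0 ≤ x.2 ∧ x.2 < 1 := by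
      rintro x (h | h)
      · exact ⟨h.2.1, h.2.2.1⟩
      · exact ⟨h.2.1, h.2.2.1.trans betaTransform_mem.2⟩
    rintro ⟨a, w⟩ hx ⟨a', w'⟩ hx' h
    have h1 := hw _ hx
    have h2 := hw _ hx'
    simp only at h h1 h2
    rw [div_left_inj' h0.ne'] at h
    have ha : a = a' := by
      have h3 : (a : ℝ) < a' + 1 := by linarith
      have h4 : (a' : ℝ) < a + 1 := by linarith
      have h5 : a < a' + 1 := by exact_mod_cast h3
      have h6 : a' < a + 1 := by exact_mod_cast h4
      omega
    subst ha
    simpa using h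

/-! ### Asymptotics of the counts -/

/-- The recursion for the counts, unfolded along the orbit of `1`. The final `1` counts `z = 0` in
`[0, r_{j+k})`, which is a nonempty interval as `β` is not simple. -/
theorem ncard_terminatingPoints_renyiRemainder {β : ℝ} (hβ : IsNonSimpleParryNumber β) (k j : ℕ) :
    ((terminatingPoints β k (renyiRemainder β j)).ncard : ℝ) =
      ∑ i ∈ Finset.range k,
        (renyiDigit β (j + i) : ℝ) * (terminatingPoints β (k - 1 - i) 1).ncard + 1 := by
  have hβ1 : 1 < β := hβ.1.1
  induction k generalizing j with
  | zero => simp [terminatingPoints_zero β (renyiRemainder_pos hβ j)]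
  | succ k ih =>
    have hT : betaTransform β (renyiRemainder β j) = renyiRemainder β (j + 1) :=
      (Function.iterate_succ_apply' _ _ _).symm
    have hr := (renyiRemainder_mem β j).1
    have hd : ((⌊β * renyiRemainder β j⌋₊ : ℕ) : ℝ) = renyiDigit β j := by
      rw [natCast_floor_eq_intCast_floor (mul_nonneg (by linarith) hr)]
      rfl
    rw [ncard_terminatingPoints_succ hβ1 k hr, hT, Nat.cast_add, Nat.cast_mul, ih, hd,
      Finset.sum_range_succ']
    simp only [add_zero, Nat.sub_zero, Nat.add_sub_cancel]
    have : ∀ i, j + 1 + i = j + (i + 1) := fun i => by ring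
    simp only [this, Nat.sub_sub, add_comm 1]
    ring

open Filter Topology in
theorem tendsto_ncard_terminatingPoints {β : ℝ} (hβ : IsNonSimpleParryNumber β) :
    Tendsto (fun k => ((terminatingPoints β k 1).ncard : ℝ) / β ^ k) atTop
      (𝓝 (β / (β - 1) / ∑' j, renyiRemainder β j / β ^ j)) := by
  have hβ1 : 1 < β := hβ.1.1
  have h0 : 0 < β := by linarith
  have hinv : β⁻¹ < 1 := inv_lt_one_of_one_lt₀ hβ1
  set u : ℕ → ℝ := fun k => ((terminatingPoints β k 1).ncard : ℝ) / β ^ k with hu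
  set a : ℕ → ℝ := fun i => renyiDigit β i / β ^ (i + 1) with ha
  set R : ℕ → ℝ := fun j => renyiRemainder β j / β ^ j with hR
  set e : ℕ → ℝ := fun k => β⁻¹ ^ (k + 1) with he
  have ha_nonneg : ∀ i, 0 ≤ a i := fun i =>
    div_nonneg (by exact_mod_cast renyiDigit_nonneg hβ1 i) (by positivity)
  have hR_nonneg : ∀ j, 0 ≤ R j := fun j => div_nonneg (renyiRemainder_mem β j).1 (by positivity)
  have hu_nonneg : ∀ k, 0 ≤ u k := fun k => by positivity
  have ha0 : 0 < a 0 := by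
    refine div_pos (Int.cast_pos.2 (Int.floor_pos.2 ?_)) (by positivity)
    simpa using hβ1.le
  have hR0 : R 0 = 1 := by simp [hR, renyiRemainder]
  have hRsucc : ∀ j, R (j + 1) = R j - a j := fun j => by
    simp only [hR, ha, renyiRemainder_succ]
    field_simp
    ring
  have hRs : Summable R := summable_renyiRemainder_div_pow hβ1
  have hasum : HasSum a 1 := by
    rw [hasSum_iff_tendsto_nat_of_nonneg ha_nonneg]
    have hpart : ∀ n, ∑ i ∈ Finset.range n, a i = 1 - R n := by
      intro n
      induction n with
      | zero => simp [hR0]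
      | succ n ih => rw [Finset.sum_range_succ, ih, hRsucc]; ring
    simp only [hpart]
    simpa using hRs.tendsto_atTop_zero.const_sub 1
  have hrec : ∀ k, u (k + 1) = ∑ i ∈ Finset.range (k + 1), a i * u (k - i) + e k := by
    intro k
    have h1 := ncard_terminatingPoints_renyiRemainder hβ (k + 1) 0
    simp only [renyiRemainder, Function.iterate_zero, id, zero_add, Nat.add_sub_cancel] at h1
    simp only [hu, h1, add_div, Finset.sum_div]
    congr 1
    · refine Finset.sum_congr rfl fun i hi => ?_
      have hik : i ≤ k := Nat.lt_succ_iff.1 (Finset.mem_range.1 hi)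
      have : β ^ (k + 1) = β ^ (i + 1) * β ^ (k - i) := by
        rw [← pow_add]
        congr 1
        omega
      simp only [ha]
      rw [this, div_mul_div_comm]
    · simp [he]
  have hconv : ∀ k, ∑ j ∈ Finset.range (k + 1), R j * u (k - j) =
      ∑ j ∈ Finset.range (k + 1), β⁻¹ ^ j := by
    intro k
    induction k with
    | zero =>
      simp [hR0, hu, terminatingPoints_zero β one_pos]
    | succ k ih =>
      rw [sum_succ_convolution_of_renewal hR0 hRsucc hrec, ih, Finset.sum_range_succ _ (k + 1)]
  have hgeom := hasSum_geometric_of_lt_one (inv_nonneg.2 h0.le) hinv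
  have hubound : ∀ k, |u k| ≤ (1 - β⁻¹)⁻¹ := by
    intro k
    rw [abs_of_nonneg (hu_nonneg k)]
    -- The term of index `0` in the convolution is `u k` itself, and all terms are nonnegative.
    calc u k = R 0 * u (k - 0) := by simp [hR0]
      _ ≤ ∑ j ∈ Finset.range (k + 1), R j * u (k - j) :=
        Finset.single_le_sum (f := fun j => R j * u (k - j))
          (fun j _ => mul_nonneg (hR_nonneg j) (hu_nonneg _)) (Finset.mem_range.2 k.succ_pos)
      _ = ∑ j ∈ Finset.range (k + 1), β⁻¹ ^ j := hconv k
      _ ≤ (1 - β⁻¹)⁻¹ := sum_le_hasSum _ (fun j _ => by positivity) hgeom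
  have hS : Tendsto (fun k => ∑ j ∈ Finset.range (k + 1), R j * u (k - j)) atTop
      (𝓝 (1 - β⁻¹)⁻¹) := by
    simp only [hconv]
    exact hgeom.tendsto_sum_nat.comp (tendsto_add_atTop_nat 1)
  have hetend : Tendsto e atTop (𝓝 0) :=
    (tendsto_pow_atTop_nhds_zero_of_lt_one (inv_nonneg.2 h0.le) hinv).comp
      (tendsto_add_atTop_nat 1)
  have hmain := tendsto_of_renewal ha_nonneg ha0 hasum hR_nonneg (by rw [hR0]; exact one_pos) hRs
    hubound hrec hetend hS
  have hc : (1 - β⁻¹)⁻¹ = β / (β - 1) := by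
    have : β - 1 ≠ 0 := by linarith
    rw [inv_eq_one_div, div_eq_div_iff (by linarith) this]
    field_simp
  rwa [hc] at hmain

open Filter Topology in
/-- `F_k(y)` is `c β ^ k y` up to a small multiple of `β ^ k y` and a constant independent of `k` and
`y`. In the induction on `k` the leading digits of `y` contribute errors proportional to
`⌊β y⌋ β ^ k`, which add up to `β ^ (k+1) y`, so the constant does not grow. -/
theorem abs_ncard_terminatingPoints_sub_le {β c : ℝ} (hβ : 1 < β)
    (h : Tendsto (fun k => ((terminatingPoints β k 1).ncard : ℝ) / β ^ k) atTop (𝓝 c)) {ε : ℝ}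
    (hε : 0 < ε) : ∃ (J : ℕ) (C : ℝ), ∀ k, J ≤ k → ∀ y, 0 ≤ y → y ≤ 1 →
      |((terminatingPoints β k y).ncard : ℝ) - c * (β ^ k * y)| ≤ ε * (β ^ k * y) + C := by
  have h0 : 0 < β := by linarith
  obtain ⟨J, hJ⟩ := Metric.tendsto_atTop.1 h ε hε
  have hU : ∀ k, J ≤ k → |((terminatingPoints β k 1).ncard : ℝ) - c * β ^ k| ≤ ε * β ^ k := by
    intro k hk
    have hpos : 0 < β ^ k := by positivity
    have h1 := (hJ k hk).le
    rw [Real.dist_eq, div_sub' hpos.ne', abs_div, abs_of_pos hpos, div_le_iff₀ hpos] at h1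
    rwa [mul_comm c]
  refine ⟨J, (terminatingPoints β J 1).ncard + |c| * β ^ J, fun k hk => ?_⟩
  induction k, hk using Nat.le_induction with
  | base =>
    intro y hy0 hy1
    have h1 : ((terminatingPoints β J y).ncard : ℝ) ≤ (terminatingPoints β J 1).ncard := by
      exact_mod_cast Set.ncard_le_ncard (terminatingPoints_mono β J hy1)
        (finite_terminatingPoints hβ J zero_le_one)
    have h2 : |c * (β ^ J * y)| ≤ |c| * β ^ J := by
      rw [abs_mul, abs_of_nonneg (by positivity : 0 ≤ β ^ J * y)]
      gcongr
      exact mul_le_of_le_one_right (by positivity) hy1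
    have h3 : 0 ≤ ε * (β ^ J * y) := by positivity
    refine (abs_sub _ _).trans ?_
    rw [abs_of_nonneg (Nat.cast_nonneg _)]
    linarith
  | succ k hk ih =>
    intro y hy0 hy1
    have hT := ih (betaTransform β y) betaTransform_mem.1 betaTransform_mem.2.le
    have hsplit : β * y = ⌊β * y⌋₊ + betaTransform β y := by
      rw [natCast_floor_eq_intCast_floor (mul_nonneg h0.le hy0), betaTransform,
        Int.floor_add_fract]
    have hbound := mul_le_mul_of_nonneg_left (hU k hk) (Nat.cast_nonneg (α := ℝ) ⌊β * y⌋₊)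
    rw [ncard_terminatingPoints_succ hβ k hy0]
    push_cast
    have hpow : β ^ (k + 1) * y = ⌊β * y⌋₊ * β ^ k + β ^ k * betaTransform β y := by
      linear_combination β ^ k * hsplit
    rw [hpow]
    calc _ = |⌊β * y⌋₊ * ((terminatingPoints β k 1).ncard - c * β ^ k) +
          ((terminatingPoints β k (betaTransform β y)).ncard -
            c * (β ^ k * betaTransform β y))| := by congr 1; ring
      _ ≤ _ := abs_add_le _ _
      _ ≤ _ := by
        rw [abs_mul, Nat.abs_cast]
        linarith

/-! ### Counting `β`-integers -/

/-- The greedy expansion of `x < β ^ k`, started at the top position of `x`, agrees with the orbit of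
`x / β ^ k` under `T_β`, which begins with zero digits. -/
theorem mem_nonnegBetaIntegers_iff {β : ℝ} (hβ : 1 < β) {k : ℕ} {x : ℝ} (hx0 : 0 ≤ x)
    (hxk : x < β ^ k) :
    x ∈ nonnegBetaIntegers β ↔ (betaTransform β)^[k] (x / β ^ k) = 0 := by
  have h0 : 0 < β := by linarith
  have hT0 : betaTransform β 0 = 0 := by simp [betaTransform]
  rcases hx0.eq_or_lt with rfl | hx
  · rw [zero_div, Function.iterate_fixed hT0]
    simp [zero_mem_nonnegBetaIntegers]
  obtain ⟨hK1, hK2⟩ := betaTop_spec hβ hx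
  set K := betaTop β x with hK
  have hKk : K < k := by
    rw [← zpow_natCast] at hxk
    exact (zpow_lt_zpow_iff_right₀ hβ).1 (hK1.trans_lt hxk)
  -- Above the top position the transformation only rescales.
  have hshift : ∀ i : ℕ, K < k - i → (betaTransform β)^[i] (x / β ^ k) = x / β ^ ((k : ℤ) - i) := by
    intro i
    induction i with
    | zero => simp
    | succ i ih =>
      intro hi
      push_cast at hi
      have h1 : β * (x / β ^ ((k : ℤ) - i)) = x / β ^ ((k : ℤ) - (i + 1 : ℕ)) := by
        rw [show (k : ℤ) - i = (k - (i + 1 : ℕ)) + 1 by push_cast; ring, zpow_add_one₀ h0.ne']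
        field_simp
      rw [Function.iterate_succ_apply', ih (by omega), betaTransform, h1, Int.fract_eq_self]
      refine ⟨by positivity, ?_⟩
      rw [div_lt_one (by positivity)]
      refine hK2.trans_le (zpow_le_zpow_right₀ hβ.le ?_)
      push_cast
      omega
  have hrem : ∀ j : ℕ, (betaTransform β)^[(k - K).toNat + j] (x / β ^ k) =
      betaRemainder β x j := by
    intro j
    induction j with
    | zero =>
      obtain ⟨i, hi⟩ : ∃ i, (k - K).toNat = i + 1 := ⟨(k - K).toNat - 1, by omega⟩
      rw [add_zero, hi, Function.iterate_succ_apply', hshift i (by omega), betaTransform,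
        betaRemainder, ← hK, show (k : ℤ) - i = K + 1 by omega, zpow_add_one₀ h0.ne']
      congr 1
      field_simp
    | succ j ih =>
      rw [← add_assoc, Function.iterate_succ_apply', ih]
      rfl
  constructor
  · intro h
    obtain ⟨n, hn, hsum⟩ := nonnegBetaIntegers_eq_sum hβ hx h
    have h1 := betaExpansion_partial β x n
    rw [← hsum, hn, zpow_natCast, mul_div_cancel₀ _ (pow_pos h0 n).ne'] at h1
    have h2 := hrem n
    rw [show (k - K).toNat + n = k by omega] at h2
    rw [h2]
    linarith
  · intro h
    have hKnonneg : 0 ≤ K := by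
      by_contra hneg
      rw [hshift k (by omega), sub_self, zpow_zero, div_one] at h
      exact hx.ne' h
    obtain ⟨n, hn⟩ := Int.eq_ofNat_of_zero_le hKnonneg
    have hzero : ∀ j, betaRemainder β x (n + j) = 0 := by
      intro j
      rw [← hrem, show (k - K).toNat + (n + j) = j + k by omega, Function.iterate_add_apply, h,
        Function.iterate_fixed hT0]
    refine ⟨hx0, fun i hi => ?_⟩
    rw [betaDigit, if_pos ⟨hx, by omega⟩, ← hK]
    obtain ⟨j, hj⟩ : ∃ j, (K - i).toNat = n + j + 1 := ⟨(K - i).toNat - n - 1, by omega⟩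
    rw [hj]
    simp [betaDigitFromTop, hzero]

/-- The index of a `β`-integer counts the `β`-integers below it. -/
theorem ncard_terminatingPoints_betaInteger {β : ℝ} (hβ : 1 < β) {b : ℕ → ℝ}
    (hb : IsBetaIntegerSequence β b) {n k : ℕ} (hnk : b n ≤ β ^ k) :
    (terminatingPoints β k (b n / β ^ k)).ncard = n := by
  have h0 : 0 < β := by linarith
  have hpos : 0 < β ^ k := pow_pos h0 k
  have hset : terminatingPoints β k (b n / β ^ k) = (fun i => b i / β ^ k) '' Set.Iio n := by
    ext z
    constructor
    · rintro ⟨hz0, hzn, hz⟩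
      rw [lt_div_iff₀ hpos] at hzn
      have hmem : z * β ^ k ∈ nonnegBetaIntegers β := by
        rw [mem_nonnegBetaIntegers_iff hβ (by positivity) (hzn.trans_le hnk),
          mul_div_cancel_right₀ _ hpos.ne']
        exact hz
      rw [← hb.2.2] at hmem
      obtain ⟨i, hi⟩ := hmem
      refine ⟨i, hb.1.lt_iff_lt.1 (hi ▸ hzn), ?_⟩
      simp only [hi]
      rw [mul_div_cancel_right₀ _ hpos.ne']
    · rintro ⟨i, hi, rfl⟩
      have hmem : b i ∈ nonnegBetaIntegers β := hb.2.2 ▸ Set.mem_range_self i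
      have hlt : b i < b n := hb.1 hi
      refine ⟨div_nonneg hmem.1 hpos.le, by simp only; gcongr, ?_⟩
      exact (mem_nonnegBetaIntegers_iff hβ hmem.1 (hlt.trans_le hnk)).1 hmem
  rw [hset, Set.ncard_image_of_injective, ← Finset.coe_Iio, Set.ncard_coe_finset, Nat.card_Iio]
  intro i j hij
  exact hb.1.injective ((div_left_inj' hpos.ne').1 hij)

open Filter Topology in
theorem tendsto_index_div_betaInteger {β c : ℝ} (hβ : 1 < β) {b : ℕ → ℝ}
    (hb : IsBetaIntegerSequence β b)
    (h : Tendsto (fun k => ((terminatingPoints β k 1).ncard : ℝ) / β ^ k) atTop (𝓝 c)) :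
    Tendsto (fun n : ℕ => (n : ℝ) / b n) atTop (𝓝 c) := by
  have h0 : 0 < β := by linarith
  have hbtop : Tendsto b atTop atTop := by
    refine tendsto_atTop_atTop_of_monotone hb.1.monotone fun x => ?_
    obtain ⟨k, hk⟩ := pow_unbounded_of_one_lt x hβ
    obtain ⟨n, hn⟩ : β ^ k ∈ Set.range b := hb.2.2 ▸ pow_mem_nonnegBetaIntegers hβ k
    exact ⟨n, hn ▸ hk.le⟩
  rw [Metric.tendsto_nhds]
  intro ε hε
  obtain ⟨J, C, hC⟩ := abs_ncard_terminatingPoints_sub_le hβ h (half_pos hε)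
  filter_upwards [hbtop.eventually_gt_atTop 0, hbtop.eventually_gt_atTop (2 * C / ε)]
    with n hn hnC
  -- The constant `C` is independent of `k`, so any `k ≥ J` with `b n ≤ β ^ k` will do.
  obtain ⟨K, hK⟩ := pow_unbounded_of_one_lt (b n) hβ
  have hk : b n ≤ β ^ max J K :=
    hK.le.trans (pow_le_pow_right₀ hβ.le (le_max_right J K))
  have hpos : 0 < β ^ max J K := pow_pos h0 _
  have h1 := hC (max J K) (le_max_left J K) (b n / β ^ max J K) (by positivity)
    ((div_le_one hpos).2 hk)
  rw [ncard_terminatingPoints_betaInteger hβ hb hk, mul_div_cancel₀ _ hpos.ne'] at h1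
  rw [div_lt_iff₀ hε] at hnC
  rw [Real.dist_eq, div_sub' hn.ne', abs_div, abs_of_pos hn, div_lt_iff₀ hn, mul_comm (b n)]
  linarith

theorem mainTheorem2 (β : ℝ) (hβ : IsNonSimpleParryNumber β) (m p : ℕ)
    (hmp : IsMinimalRenyiPeriod β m p) (b : ℕ → ℝ) (hb : IsBetaIntegerSequence β b) :
    Filter.Tendsto (fun n : ℕ => b n / (n : ℝ)) Filter.atTop
      (nhds ((β - 1) / (β ^ m * (β ^ p - 1)) *
        Polynomial.aeval β (Polynomial.derivative (parryPolynomial β m p)))) := by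
  have hβ1 : 1 < β := hβ.1.1
  have h0 : 0 < β := by linarith
  have hG : 0 < ∑' j, renyiRemainder β j / β ^ j :=
    (summable_renyiRemainder_div_pow hβ1).tsum_pos
      (fun j => div_nonneg (renyiRemainder_mem β j).1 (by positivity)) 0
      (by simp [renyiRemainder])
  have hlim := tendsto_index_div_betaInteger hβ1 hb (tendsto_ncard_terminatingPoints hβ)
  have hβs : 0 < β - 1 := by linarith
  have hp : 0 < β ^ p - 1 := sub_pos.2 (one_lt_pow₀ hβ1 hmp.1.1.ne')
  have hinv := hlim.inv₀ (by positivity)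
  have heq : (β / (β - 1) / ∑' j, renyiRemainder β j / β ^ j)⁻¹ =
      (β - 1) / (β ^ m * (β ^ p - 1)) *
        Polynomial.aeval β (Polynomial.derivative (parryPolynomial β m p)) := by
    have hid := tsum_renyiRemainder_div_pow hβ1 hmp.1
    rw [inv_div, div_div_eq_mul_div, div_mul_eq_mul_div, div_eq_div_iff h0.ne' (by positivity)]
    linear_combination (β - 1) * hid
  rw [heq] at hinv
  simpa only [inv_div] using hinv
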